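/- **Theorem (NPRK order conditions, two partitions).** Let $s,p\ge 0$ be integers. An $s$-stage nonlinearly partitioned Runge–Kutta (NPRK) method is given by real coefficients $a_{ijk}$ and $b_{ij}$ ($1\le i,j,k\le s$). Applied with step size $h>0$ to a partitioned initial value problem $y'=F(y,y)$, $y(t_0)=y_0$, where $F:X\times X\to X$ and $X$ is a finite-dimensional real normed space, it produces $$Y_i=y_0+h\sum_{j,k=1}^s a_{ijk}F(Y_j,Y_k)\quad(i=1,\dots,s),\qquad y_1=y_0+h\sum_{i,j=1}^s b_{ij}F(Y_i,Y_j),$$ where the stages $Y_i=Y_i(h)$ are the solutions of the stage equations that tend to $y_0$ as $h\to0^+$. Fix a smoothness class $C^r$ with $r\ge p+1$ ($r=\infty$ and $r=\omega$, i.e. analytic, are allowed). The method *has order* $p$ if, for every such problem with $F$ of class $C^r$ near $(y_0,y_0)$ and exact solution $y$ near $t_0$, $$y(t_0+h)-y_1=\mathcal O(h^{p+1})\qquad\text{as } h\to0^+ .$$ A 2-edge-colored rooted tree is written recursively as $\tau=[\tau_1|_{a_1},\dots,\tau_m|_{a_m}]$, $m\ge0$, where $\tau_1,\dots,\tau_m$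 are the trees left when the root is removed and $a_k\in\{1,2\}$ is the color of the edge joining the root of $\tau$ to the root of $\tau_k$ (the order of the children being immaterial). Let $|\tau|$ be the number of nodes of $\tau$, and define the density by $\gamma(\tau)=|\tau|\,\gamma(\tau_1)\cdots\gamma(\tau_m)$ (so $\gamma=1$ for the one-node tree), and the elementary weight by $$\Phi(\tau)=\sum_{i,j=1}^s b_{ij}\,\phi_{ij}(\tau),\qquad \phi_{i_1i_2}(\tau)=\prod_{k=1}^m\ \sum_{u,v=1}^s a_{i_{a_k}uv}\,\phi_{uv}(\tau_k)$$ (so $\phi_{ij}=1$ for the one-node tree). Then the method has order $p$ if and only if $$\Phi(\tau)=\frac1{\gamma(\tau)}\qquad\text{for all 2-edge-colored rooted trees } \tau \text{ with } |\tau|\le p .$$ -/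

import Mathlib

open Filter Topology Asymptotics

/-- A two-partition nonlinearly partitioned Runge-Kutta (NPRK) method with `s` stages: the rank
three tensor `a` and the weight matrix `b`. -/
structure NPRKMethod (s : ℕ) where
  /-- the tensor `a_{ijk}` -/
  a : Fin s → Fin s → Fin s → ℝ
  /-- the weights `b_{ij}` -/
  b : Fin s → Fin s → ℝ

namespace NPRKMethod

variable {s : ℕ} {X : Type*} [NormedAddCommGroup X] [NormedSpace ℝ X]

/-- `Y` solves the stage equations for the step from `y₀` with step size `h`:
`Y_i = y₀ + h ∑_{j,k} a_{ijk} F(Y_j, Y_k)` for all `i`. -/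
def IsStages (M : NPRKMethod s) (F : X × X → X) (y₀ : X) (h : ℝ) (Y : Fin s → X) : Prop :=
  ∀ i, Y i = y₀ + h • ∑ j, ∑ k, M.a i j k • F (Y j, Y k)

/-- The result of the step, `y₁ = y₀ + h ∑_{i,j} b_{ij} F(Y_i, Y_j)`. -/
def update (M : NPRKMethod s) (F : X × X → X) (y₀ : X) (h : ℝ) (Y : Fin s → X) : X :=
  y₀ + h • ∑ i, ∑ j, M.b i j • F (Y i, Y j)

end NPRKMethod

/-- `y` is, near `t₀`, a solution of `y' = F(y, y)`, `y(t₀) = y₀`. -/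
def IsPartitionedSolution {X : Type*} [NormedAddCommGroup X] [NormedSpace ℝ X]
    (F : X × X → X) (t₀ : ℝ) (y₀ : X) (y : ℝ → X) : Prop :=
  y t₀ = y₀ ∧ ∀ᶠ t in 𝓝 t₀, HasDerivAt y (F (y t, y t)) t

/-- The method has order `p` (for problems of smoothness `r`): for every partitioned initial value
problem `y' = F(y, y)`, `y(t₀) = y₀` on a finite-dimensional real space, with `F` of class `C^r`
near `(y₀, y₀)`, the error of a single step started on the exact solution is `O(h^(p+1))` as the
step size `h > 0` tends to zero. The stage values are functions of `h` that solve the (in general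
implicit) stage equations and tend to `y₀`; this singles out the branch given by the implicit
function theorem among the solutions of the stage equations. -/
def NPRKMethod.HasOrder {s : ℕ} (M : NPRKMethod s) (r : WithTop ℕ∞) (p : ℕ) : Prop :=
  ∀ (X : Type) [NormedAddCommGroup X] [NormedSpace ℝ X] [FiniteDimensional ℝ X]
    (F : X × X → X) (t₀ : ℝ) (y₀ : X) (y : ℝ → X) (Y : ℝ → Fin s → X),
    ContDiffAt ℝ r F (y₀, y₀) →
    IsPartitionedSolution F t₀ y₀ y →
    (∀ᶠ h in 𝓝[>] (0 : ℝ), M.IsStages F y₀ h (Y h)) →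
    (∀ i, Tendsto (fun h => Y h i) (𝓝[>] 0) (𝓝 y₀)) →
    (fun h => y (t₀ + h) - M.update F y₀ h (Y h)) =O[𝓝[>] (0 : ℝ)] fun h => h ^ (p + 1)

/-- Rooted trees with edges of two colors, in recursive form: `node m col child` is the tree
`[τ_1|_{a_1}, …, τ_m|_{a_m}]` whose root is joined to the root of `τ_k = child k` by an edge of
color `a_k = col k`. Color `0` stands for the first argument of `F`, color `1` for the second.
The list of children is ordered; trees that differ by reordering children represent the same
rooted tree, and all the quantities below agree on them. -/
inductive EdgeColoredTree : Type
  | node (m : ℕ) (col : Fin m → Fin 2) (child : Fin m → EdgeColoredTree) : EdgeColoredTree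

namespace EdgeColoredTree

/-- The order `|τ|`: the number of nodes. -/
def order : EdgeColoredTree → ℕ
  | node _ _ child => 1 + ∑ k, (child k).order

/-- The density `γ(τ) = |τ| γ(τ_1) ⋯ γ(τ_m)`. -/
def density : EdgeColoredTree → ℕ
  | node m col child => (node m col child).order * ∏ k, (child k).density

/-- The indexed elementary weight `φ_{ij}(τ)`, for a root labelled `ij`: an edge of color `0` to a
child labelled `uv` gives the factor `a_{iuv}`, one of color `1` the factor `a_{juv}`, and the
labels of all nodes other than the root are summed over. -/
def indexedWeight {s : ℕ} (M : NPRKMethod s) : EdgeColoredTree → Fin s → Fin s → ℝ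
  | node m col child => fun i j =>
      ∏ k : Fin m, ∑ u, ∑ v, M.a (![i, j] (col k)) u v * indexedWeight M (child k) u v

/-- The elementary weight `Φ(τ) = ∑_{i,j} b_{ij} φ_{ij}(τ)`. -/
def weight {s : ℕ} (M : NPRKMethod s) (τ : EdgeColoredTree) : ℝ :=
  ∑ i, ∑ j, M.b i j * indexedWeight M τ i j

end EdgeColoredTree

/-! Sufficiency compares B-series. The exact solution and the numerical step both have an expansion
`∑ h^|τ| c(τ) D(τ)` with the same elementary differentials `D(τ)`; the coefficients are `1/γ(τ)` and
`Φ(τ)`. If these agree for `|τ| ≤ p`, only terms of size `O(h^(p+1))` remain. The trees are ordered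
and `D` carries the `1/m!`, so no symmetry factors occur. Both expansions come from Picard
iteration. By `comp_bSeries_isBigO`, inserting series over trees of `n` levels into `F` gives a
series over trees of `n + 1` levels with error `O(h^(n+1))`; multiplying by `h` (stages) or
integrating (exact solution) gains one order. Necessity uses one polynomial problem per tree,
`treeField`, with a component for each subtree `σ`. Exact solution, stages and update are explicit
monomials in `h`, and the error at `τ` is `h^|τ| (1/γ(τ) - Φ(τ))`. -/

section Taylor

universe u

/-- Induction on `n` through the derivative: integrating its expansion along the segment from `x` to
`x + z` turns `q m` into `1/(m+1)` times its uncurried form. A single universe lets the induction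
hypothesis apply to maps into `E →L[ℝ] F`. -/
theorem ContDiffAt.exists_taylor_isBigO {E F : Type u} [NormedAddCommGroup E] [NormedSpace ℝ E]
    [NormedAddCommGroup F] [NormedSpace ℝ F] {f : E → F} {x : E} (n : ℕ)
    (hf : ContDiffAt ℝ ((n : WithTop ℕ∞) + 1) f x) :
    ∃ q : FormalMultilinearSeries ℝ E F,
      (fun z => f (x + z) - ∑ m ∈ Finset.range (n + 1), q m (fun _ => z))
        =O[𝓝 0] fun z => ‖z‖ ^ (n + 1) := by
  induction n generalizing F with
  | zero =>
    refine ⟨fun m => match m with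
      | 0 => ContinuousMultilinearMap.constOfIsEmpty ℝ _ (f x)
      | _ + 1 => 0, ?_⟩
    have hd : DifferentiableAt ℝ f x := hf.differentiableAt (by simp)
    have h := hd.isBigO_sub
    have ht : Tendsto (fun z : E => x + z) (𝓝 0) (𝓝 x) := by
      simpa using (continuous_const_add x).tendsto (0 : E)
    simpa [Function.comp_def] using (h.comp_tendsto ht).norm_right
  | succ n ih =>
    have hf' : ContDiffAt ℝ ((n : WithTop ℕ∞) + 1) (fderiv ℝ f) x :=
      hf.fderiv_right (by push_cast; exact le_rfl)
    obtain ⟨q, hq⟩ := ih hf'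
    refine ⟨fun m => match m with
      | 0 => ContinuousMultilinearMap.constOfIsEmpty ℝ _ (f x)
      | m + 1 => ((m : ℝ) + 1)⁻¹ • (q m).uncurryRight, ?_⟩
    obtain ⟨C, hC⟩ := hq.bound
    have hd : ∀ᶠ z in 𝓝 x, DifferentiableAt ℝ f z := by
      have h1 : ContDiffAt ℝ 1 f x := hf.of_le (by push_cast; exact le_add_self)
      filter_upwards [h1.eventually (by simp)] with z hz using hz.differentiableAt (by simp)
    have ht : Tendsto (fun z : E => x + z) (𝓝 0) (𝓝 x) := by
      simpa using (continuous_const_add x).tendsto (0 : E)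
    obtain ⟨ε, hε, hball⟩ := Metric.eventually_nhds_iff.1 (hC.and (ht.eventually hd))
    refine IsBigO.of_bound |C| (Metric.eventually_nhds_iff.2 ⟨ε, hε, fun z hz => ?_⟩)
    rw [dist_zero_right] at hz
    have hsmall : ∀ t ∈ Set.Icc (0 : ℝ) 1, ‖t • z‖ ≤ ‖z‖ := fun t ht' => by
      rw [norm_smul, Real.norm_of_nonneg ht'.1]
      exact mul_le_of_le_one_left (norm_nonneg _) ht'.2
    -- `g 1 - g 0` is the remainder at `z`; the mean value inequality bounds it by the remainder of
    -- `fderiv ℝ f`.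
    set g : ℝ → F := fun t => f (x + t • z) -
      ∑ m ∈ Finset.range (n + 1), t ^ (m + 1) • ((m : ℝ) + 1)⁻¹ • q m (fun _ => z) z with hg
    set g' : ℝ → F := fun t =>
      (fderiv ℝ f (x + t • z) - ∑ m ∈ Finset.range (n + 1), q m (fun _ => t • z)) z with hg'
    have hderiv : ∀ t ∈ Set.Icc (0 : ℝ) 1, HasDerivWithinAt g (g' t) (Set.Icc 0 1) t := by
      intro t ht'
      have h1 : DifferentiableAt ℝ f (x + t • z) :=
        (hball (by rw [dist_zero_right]; exact (hsmall t ht').trans_lt hz)).2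
      have h2 : HasDerivAt (fun t : ℝ => x + t • z) z t := by
        simpa using ((hasDerivAt_id t).smul_const z).const_add x
      have h3 := h1.hasFDerivAt.comp_hasDerivAt t h2
      have h4 : HasDerivAt (fun t : ℝ => ∑ m ∈ Finset.range (n + 1),
          t ^ (m + 1) • ((m : ℝ) + 1)⁻¹ • q m (fun _ => z) z)
          (∑ m ∈ Finset.range (n + 1), q m (fun _ => t • z) z) t := by
        refine HasDerivAt.fun_sum fun m _ => ?_
        have h5 := (hasDerivAt_pow (m + 1) t).smul_const (((m : ℝ) + 1)⁻¹ • q m (fun _ => z) z)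
        convert h5 using 1
        have h6 : q m (fun _ => t • z) = t ^ m • q m (fun _ => z) := by
          simpa using (q m).map_smul_univ (fun _ => t) (fun _ => z)
        have h7 : (m : ℝ) + 1 ≠ 0 := by positivity
        rw [h6, smul_smul]
        simp only [_root_.smul_apply]
        congr 1
        push_cast
        field_simp
      have h8 := h3.sub h4
      refine HasDerivAt.hasDerivWithinAt ?_
      simp only [hg', _root_.sub_apply, _root_.sum_apply]
      exact h8
    have hbound : ∀ t ∈ Set.Ico (0 : ℝ) 1, ‖g' t‖ ≤ |C| * ‖z‖ ^ (n + 2) := by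
      intro t ht'
      have ht'' := Set.Ico_subset_Icc_self ht'
      have h1 := (hball (y := t • z)
        (by rw [dist_zero_right]; exact (hsmall t ht'').trans_lt hz)).1
      calc ‖g' t‖ ≤ _ * ‖z‖ := ContinuousLinearMap.le_opNorm _ _
        _ ≤ (|C| * ‖z‖ ^ (n + 1)) * ‖z‖ := by
          gcongr
          refine h1.trans ?_
          rw [norm_pow, norm_norm]
          have := hsmall t ht''
          gcongr
          exact le_abs_self C
        _ = _ := by ring
    have hfin := norm_image_sub_le_of_norm_deriv_le_segment_01' hderiv hbound
    rw [norm_pow, norm_norm]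
    refine le_trans (le_of_eq ?_) hfin
    congr 1
    rw [Finset.sum_range_succ']
    have hinit : ∀ m : ℕ, (Fin.init fun _ : Fin (m + 1) => z) = fun _ => z := fun m => rfl
    simp [hg, hinit]
    abel

end Taylor

theorem isBigO_of_hasDerivAt_isBigO {X : Type*} [NormedAddCommGroup X] [NormedSpace ℝ X]
    {g g' : ℝ → X} {n : ℕ} (h0 : g 0 = 0) (hd : ∀ᶠ t in 𝓝 0, HasDerivAt g (g' t) t)
    (hg : g' =O[𝓝 0] fun t => t ^ n) : g =O[𝓝 0] fun t => t ^ (n + 1) := by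
  obtain ⟨C, hC⟩ := hg.bound
  obtain ⟨ε, hε, hball⟩ := Metric.eventually_nhds_iff.1 (hC.and hd)
  refine IsBigO.of_bound |C| (Metric.eventually_nhds_iff.2 ⟨ε, hε, fun t ht => ?_⟩)
  have hsub : ∀ u ∈ Metric.closedBall (0 : ℝ) |t|, dist u 0 < ε := fun u hu =>
    (Metric.mem_closedBall.1 hu).trans_lt (by simpa using ht)
  have h := (convex_closedBall (0 : ℝ) |t|).norm_image_sub_le_of_norm_hasDerivWithin_le
    (f := g) (f' := g') (C := |C| * |t| ^ n) (x := 0) (y := t)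
    (fun u hu => (hball (hsub u hu)).2.hasDerivWithinAt)
    (fun u hu => (hball (hsub u hu)).1.trans (by
      rw [norm_pow, Real.norm_eq_abs]
      have : |u| ≤ |t| := by simpa using hu
      gcongr
      exact le_abs_self C)) (by simp) (by simp)
  simpa [h0, pow_succ, mul_assoc] using h

/-! ### Necessity: the test problem of a tree -/

namespace EdgeColoredTree

/-- The subtrees of a tree: the tree itself and the subtrees of its children. -/
def subtrees : EdgeColoredTree → Set EdgeColoredTree
  | node m col child => insert (node m col child) (⋃ k, (child k).subtrees)

theorem self_mem_subtrees (τ : EdgeColoredTree) : τ ∈ τ.subtrees := by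
  cases τ; simp [subtrees]

theorem finite_subtrees (τ : EdgeColoredTree) : τ.subtrees.Finite := by
  induction τ with
  | node m col child ih =>
    rw [subtrees]
    exact (Set.finite_iUnion ih).insert _

theorem child_mem_subtrees {τ : EdgeColoredTree} {m : ℕ} {col : Fin m → Fin 2}
    {child : Fin m → EdgeColoredTree} (h : node m col child ∈ τ.subtrees) (k : Fin m) :
    child k ∈ τ.subtrees := by
  induction τ with
  | node m' col' child' ih =>
    rw [subtrees] at h ⊢
    rcases h with h | h
    · injection h with h1 h2 h3
      subst h1
      obtain rfl := eq_of_heq h3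
      exact Or.inr (Set.mem_iUnion.2 ⟨k, self_mem_subtrees _⟩)
    · obtain ⟨l, hl⟩ := Set.mem_iUnion.1 h
      exact Or.inr (Set.mem_iUnion.2 ⟨l, ih l hl⟩)

theorem order_pos (τ : EdgeColoredTree) : 0 < τ.order := by
  cases τ; rw [order]; omega

theorem density_pos (τ : EdgeColoredTree) : 0 < τ.density := by
  induction τ with
  | node m col child ih =>
    rw [density]
    exact Nat.mul_pos (order_pos _) (Finset.prod_pos fun k _ => ih k)

theorem order_div_density {m : ℕ} (col : Fin m → Fin 2) (child : Fin m → EdgeColoredTree) :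
    ((node m col child).order : ℝ) * (1 / ((node m col child).density : ℝ)) =
      ∏ k, 1 / ((child k).density : ℝ) := by
  have h : ((node m col child).order : ℝ) ≠ 0 := by exact_mod_cast (order_pos _).ne'
  rw [density]
  push_cast
  rw [Finset.prod_div_distrib, Finset.prod_const_one]
  field_simp

/-- The weight of a tree grafted on a stage: `∑_{u,v} a_{iuv} φ_{uv}(τ)`. -/
def stageWeight {s : ℕ} (M : NPRKMethod s) (i : Fin s) (τ : EdgeColoredTree) : ℝ :=
  ∑ u, ∑ v, M.a i u v * indexedWeight M τ u v

theorem indexedWeight_node {s : ℕ} (M : NPRKMethod s) {m : ℕ} (col : Fin m → Fin 2)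
    (child : Fin m → EdgeColoredTree) (i j : Fin s) :
    indexedWeight M (node m col child) i j =
      ∏ k, (![stageWeight M i, stageWeight M j] (col k)) (child k) := by
  rw [indexedWeight]
  refine Finset.prod_congr rfl fun k _ => ?_
  generalize col k = c
  fin_cases c <;> rfl

/-- The vector field, on the space of real functions on the subtrees of `τ`, whose component at
`σ = [σ_1|_{a_1}, …, σ_m|_{a_m}]` is the product of the components at the `σ_k` of the first or
second argument, according to the colors `a_k`. -/
def treeField (τ : EdgeColoredTree) (z : (τ.subtrees → ℝ) × (τ.subtrees → ℝ)) :
    τ.subtrees → ℝ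
  | ⟨node _ col child, h⟩ => ∏ k, ![z.1, z.2] (col k) ⟨child k, child_mem_subtrees h k⟩

theorem contDiff_treeField (τ : EdgeColoredTree) [Fintype τ.subtrees] {n : WithTop ℕ∞} :
    ContDiff ℝ n τ.treeField := by
  refine contDiff_pi.2 ?_
  rintro ⟨⟨m, col, child⟩, h⟩
  refine contDiff_prod fun k _ => ?_
  generalize col k = c
  fin_cases c
  · exact (contDiff_apply ℝ ℝ _).comp contDiff_fst
  · exact (contDiff_apply ℝ ℝ _).comp contDiff_snd

theorem treeField_pow (τ : EdgeColoredTree) (c : Fin 2 → EdgeColoredTree → ℝ) (h : ℝ)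
    {m : ℕ} (col : Fin m → Fin 2) (child : Fin m → EdgeColoredTree)
    (hσ : node m col child ∈ τ.subtrees) :
    τ.treeField (fun σ => h ^ σ.1.order * c 0 σ.1, fun σ => h ^ σ.1.order * c 1 σ.1)
        ⟨node m col child, hσ⟩ =
      h ^ ((node m col child).order - 1) * ∏ k, c (col k) (child k) := by
  have h1 : (node m col child).order - 1 = ∑ k, (child k).order := by rw [order]; omega
  rw [treeField, h1, ← Finset.prod_pow_eq_pow_sum, ← Finset.prod_mul_distrib]
  refine Finset.prod_congr rfl fun k _ => ?_
  generalize col k = d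
  fin_cases d <;> rfl

theorem isPartitionedSolution_treeField (τ : EdgeColoredTree) [Fintype τ.subtrees] :
    IsPartitionedSolution τ.treeField 0 0
      fun t σ => t ^ σ.1.order * (1 / (σ.1.density : ℝ)) := by
  refine ⟨?_, Eventually.of_forall fun t => hasDerivAt_pi.2 ?_⟩
  · funext σ
    simp [(order_pos σ.1).ne']
  · rintro ⟨⟨m, col, child⟩, h⟩
    rw [treeField_pow τ (fun _ σ => 1 / (σ.density : ℝ)) t col child h, ← order_div_density col]
    have := (hasDerivAt_pow (node m col child).order t).mul_const
      (1 / ((node m col child).density : ℝ))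
    refine this.congr_deriv ?_
    ring

/-- With `c = M.a i` this is the stage equation, with `c = M.b` the update. -/
theorem pow_order_mul_stages (τ : EdgeColoredTree) {s : ℕ} (M : NPRKMethod s) (h : ℝ)
    (c : Fin s → Fin s → ℝ) :
    h • ∑ u, ∑ v, c u v • τ.treeField
      (fun σ => h ^ σ.1.order * stageWeight M u σ.1,
        fun σ => h ^ σ.1.order * stageWeight M v σ.1) =
      fun σ => h ^ σ.1.order * ∑ u, ∑ v, c u v * indexedWeight M σ.1 u v := by
  funext ⟨⟨m, col, child⟩, hσ⟩
  have h1 : h ^ (node m col child).order = h * h ^ ((node m col child).order - 1) := by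
    rw [← pow_succ', Nat.sub_add_cancel (order_pos _)]
  simp only [Finset.sum_apply, Pi.smul_apply, smul_eq_mul]
  rw [h1, mul_assoc]
  congr 1
  rw [Finset.mul_sum]
  refine Finset.sum_congr rfl fun u _ => ?_
  rw [Finset.mul_sum]
  refine Finset.sum_congr rfl fun v _ => ?_
  have h2 := treeField_pow τ ![stageWeight M u, stageWeight M v] h col child hσ
  simp only [Matrix.cons_val_zero, Matrix.cons_val_one] at h2
  rw [h2, indexedWeight_node]
  ring

end EdgeColoredTree

open EdgeColoredTree in
theorem NPRKMethod.HasOrder.weight_eq {s : ℕ} {M : NPRKMethod s} {r : WithTop ℕ∞} {p : ℕ}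
    (hM : M.HasOrder r p) (τ : EdgeColoredTree) (hτ : τ.order ≤ p) :
    τ.weight M = 1 / (τ.density : ℝ) := by
  let : Fintype τ.subtrees := τ.finite_subtrees.fintype
  have key := hM (τ.subtrees → ℝ) τ.treeField 0 0 _
    (fun h i σ => h ^ σ.1.order * stageWeight M i σ.1) τ.contDiff_treeField.contDiffAt
    τ.isPartitionedSolution_treeField
    (Eventually.of_forall fun h i => by
      rw [τ.pow_order_mul_stages M h (M.a i), zero_add]; rfl)
    (fun i => by
      refine tendsto_nhdsWithin_of_tendsto_nhds (tendsto_pi_nhds.2 fun σ => ?_)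
      have : Continuous fun h : ℝ => h ^ σ.1.order * stageWeight M i σ.1 := by fun_prop
      simpa [(order_pos σ.1).ne'] using this.tendsto 0)
  have hupd : ∀ h : ℝ, M.update τ.treeField 0 h
      (fun i σ => h ^ σ.1.order * stageWeight M i σ.1) =
        fun σ => h ^ σ.1.order * σ.1.weight M := fun h => by
    rw [NPRKMethod.update, τ.pow_order_mul_stages M h M.b, zero_add]; rfl
  simp only [hupd, zero_add] at key
  have key' := isBigO_pi.1 key ⟨τ, τ.self_mem_subtrees⟩
  simp only [Pi.sub_apply, ← mul_sub] at key'
  -- Since `|τ| ≤ p`, an error `O(h^(p+1))` is `o(h^|τ|)`, so the constant factor must vanish.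
  have h1 : (fun h : ℝ => h ^ τ.order * (1 / (τ.density : ℝ) - τ.weight M))
      =o[𝓝[>] 0] fun h => h ^ τ.order :=
    key'.trans_isLittleO ((isLittleO_pow_pow (by omega)).mono nhdsWithin_le_nhds)
  have h2 : (fun _ : ℝ => 1 / (τ.density : ℝ) - τ.weight M) =o[𝓝[>] 0] fun _ => (1 : ℝ) := by
    refine IsLittleO.of_bound fun c hc => ?_
    filter_upwards [h1.bound hc, self_mem_nhdsWithin] with h hh hpos
    have : 0 < ‖h ^ τ.order‖ := norm_pos_iff.2 (pow_ne_zero _ (ne_of_gt hpos))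
    rw [norm_mul, mul_comm] at hh
    simpa using le_of_mul_le_mul_right hh this
  have h3 := isLittleO_const_const_iff.1 h2
  linarith

/-! ### B-series and their composition with `F` -/

namespace EdgeColoredTree

/-- The tree with the given list of colored children. -/
def ofChildren : (Σ m : ℕ, Fin m → Fin 2 × EdgeColoredTree) ↪ EdgeColoredTree where
  toFun x := node x.1 (fun k => (x.2 k).1) fun k => (x.2 k).2
  inj' := by
    rintro ⟨m, x⟩ ⟨m', x'⟩ h
    injection h with h1 h2 h3
    subst h1
    have h2 := eq_of_heq h2
    have h3 := eq_of_heq h3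
    congr 1
    funext k
    exact Prod.ext (congrFun h2 k) (congrFun h3 k)

/-- The trees with at most `n` levels, all of whose nodes have at most `p` children. -/
def boundedTrees (p : ℕ) : ℕ → Finset EdgeColoredTree
  | 0 => ∅
  | n + 1 => ((Finset.range (p + 1)).sigma fun m =>
      Fintype.piFinset fun _ : Fin m => Finset.univ ×ˢ boundedTrees p n).map ofChildren

/-- The product of the values of `c` at the children, chosen by the color of the edge. -/
def childProd (c : Fin 2 → EdgeColoredTree → ℝ) : EdgeColoredTree → ℝ
  | node _ col child => ∏ k, c (col k) (child k)

variable {X : Type*} [NormedAddCommGroup X] [NormedSpace ℝ X]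

/-- The inclusion of the first or the second factor of `X × X`. -/
noncomputable def slot (X : Type*) [NormedAddCommGroup X] [NormedSpace ℝ X] (a : Fin 2) :
    X →L[ℝ] X × X :=
  ![ContinuousLinearMap.inl ℝ X X, ContinuousLinearMap.inr ℝ X X] a

/-- The elementary differentials of a function on `X × X` with Taylor coefficients `q`. The
coefficients contain the factors `1 / m!`. -/
noncomputable def elemDiff (q : FormalMultilinearSeries ℝ (X × X) X) : EdgeColoredTree → X
  | node m col child => q m fun k => slot X (col k) (elemDiff q (child k))

/-- The B-series with coefficients `c`, truncated to `boundedTrees p n`. -/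
noncomputable def bSeries (q : FormalMultilinearSeries ℝ (X × X) X) (p n : ℕ)
    (c : EdgeColoredTree → ℝ) (h : ℝ) : X :=
  ∑ τ ∈ boundedTrees p n, (h ^ τ.order * c τ) • elemDiff q τ

theorem bSeries_prod (q : FormalMultilinearSeries ℝ (X × X) X) (p n : ℕ)
    (c : Fin 2 → EdgeColoredTree → ℝ) (h : ℝ) :
    (bSeries q p n (c 0) h, bSeries q p n (c 1) h) =
      ∑ x ∈ Finset.univ ×ˢ boundedTrees p n,
        (h ^ x.2.order * c x.1 x.2) • slot X x.1 (elemDiff q x.2) := by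
  rw [Finset.sum_product, Fin.sum_univ_two]
  simp only [← map_smul, ← map_sum]
  ext <;> simp [slot, bSeries, Prod.fst_sum, Prod.snd_sum]

/-- Multilinear expansion of `q m` chooses `m` colored trees in order, which is the same as grafting
them on a new root. The identity is exact because `p` bounds both the degree and the number of
children. -/
theorem taylorPolynomial_bSeries (q : FormalMultilinearSeries ℝ (X × X) X) (p n : ℕ)
    (c : Fin 2 → EdgeColoredTree → ℝ) (h : ℝ) :
    ∑ m ∈ Finset.range (p + 1),
        q m (fun _ => (bSeries q p n (c 0) h, bSeries q p n (c 1) h)) =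
      ∑ τ ∈ boundedTrees p (n + 1), (h ^ (τ.order - 1) * childProd c τ) • elemDiff q τ := by
  rw [boundedTrees, Finset.sum_map, Finset.sum_sigma]
  refine Finset.sum_congr rfl fun m _ => ?_
  rw [bSeries_prod, ContinuousMultilinearMap.map_sum_finset]
  refine Finset.sum_congr rfl fun x _ => ?_
  rw [ContinuousMultilinearMap.map_smul_univ, Finset.prod_mul_distrib,
    Finset.prod_pow_eq_pow_sum]
  have h1 : (ofChildren ⟨m, x⟩).order - 1 = ∑ k, (x k).2.order := by
    change (node _ _ _).order - 1 = _
    rw [order]; exact Nat.add_sub_cancel_left ..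
  rw [h1]
  rfl

theorem smul_sum_childProd (q : FormalMultilinearSeries ℝ (X × X) X) (p n : ℕ)
    (c : Fin 2 → EdgeColoredTree → ℝ) (h : ℝ) :
    h • ∑ τ ∈ boundedTrees p n, (h ^ (τ.order - 1) * childProd c τ) • elemDiff q τ =
      bSeries q p n (childProd c) h := by
  rw [bSeries, Finset.smul_sum]
  refine Finset.sum_congr rfl fun τ _ => ?_
  rw [smul_smul, ← mul_assoc, ← pow_succ', Nat.sub_add_cancel τ.order_pos]

theorem bSeries_sum {ι : Type*} (q : FormalMultilinearSeries ℝ (X × X) X) (p n : ℕ)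
    (I : Finset ι) (c : ι → EdgeColoredTree → ℝ) (h : ℝ) :
    bSeries q p n (fun τ => ∑ i ∈ I, c i τ) h = ∑ i ∈ I, bSeries q p n (c i) h := by
  simp only [bSeries, Finset.mul_sum, Finset.sum_smul]
  rw [Finset.sum_comm]

theorem bSeries_const_mul (q : FormalMultilinearSeries ℝ (X × X) X) (p n : ℕ)
    (w : ℝ) (c : EdgeColoredTree → ℝ) (h : ℝ) :
    bSeries q p n (fun τ => w * c τ) h = w • bSeries q p n c h := by
  simp only [bSeries, Finset.smul_sum, smul_smul, mul_left_comm]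

theorem isBigO_pow_smul_const {l : Filter ℝ} (hl : l ≤ 𝓝 0) {m n : ℕ} (hmn : n ≤ m) (x : X) :
    (fun h : ℝ => h ^ m • x) =O[l] fun h => h ^ n := by
  have h1 : (fun h : ℝ => h ^ m) =O[l] fun h => h ^ n := by
    rcases hmn.eq_or_lt with rfl | hmn
    · exact isBigO_refl _ _
    · exact (isLittleO_pow_pow hmn).isBigO.mono hl
  simpa using h1.smul (isBigO_refl (fun _ : ℝ => x) l |>.trans (isBigO_const_one ℝ x l))

theorem bSeries_isBigO (q : FormalMultilinearSeries ℝ (X × X) X) (p n : ℕ)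
    (c : EdgeColoredTree → ℝ) {l : Filter ℝ} (hl : l ≤ 𝓝 0) :
    bSeries q p n c =O[l] fun h => h := by
  change (fun h => ∑ τ ∈ boundedTrees p n, (h ^ τ.order * c τ) • elemDiff q τ) =O[l] _
  refine IsBigO.fun_sum fun τ _ => ?_
  simp only [mul_smul]
  simpa using isBigO_pow_smul_const hl τ.order_pos (c τ • elemDiff q τ)

/-- `F` is Lipschitz near `z`, so it preserves the error of its arguments; the Taylor remainder
`O(h^(p+1))` is absorbed as `n ≤ p`. -/
theorem comp_bSeries_isBigO {F : X × X → X} {z : X × X}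
    {q : FormalMultilinearSeries ℝ (X × X) X} {p n : ℕ} (hn : n ≤ p)
    (hF : ContDiffAt ℝ 1 F z)
    (hq : (fun w => F (z + w) - ∑ m ∈ Finset.range (p + 1), q m (fun _ => w))
        =O[𝓝 0] fun w => ‖w‖ ^ (p + 1))
    {l : Filter ℝ} (hl : l ≤ 𝓝 0) (c : Fin 2 → EdgeColoredTree → ℝ) {u v : ℝ → X}
    (hu : (fun h => u h - z.1 - bSeries q p n (c 0) h) =O[l] fun h => h ^ (n + 1))
    (hv : (fun h => v h - z.2 - bSeries q p n (c 1) h) =O[l] fun h => h ^ (n + 1)) :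
    (fun h => F (u h, v h) -
        ∑ τ ∈ boundedTrees p (n + 1), (h ^ (τ.order - 1) * childProd c τ) • elemDiff q τ)
      =O[l] fun h => h ^ (n + 1) := by
  set W : ℝ → X × X := fun h => (bSeries q p n (c 0) h, bSeries q p n (c 1) h) with hW
  have hid : Tendsto (fun h : ℝ => h) l (𝓝 0) := hl
  have hWO : W =O[l] fun h => h :=
    (bSeries_isBigO q p n (c 0) hl).prod_left (bSeries_isBigO q p n (c 1) hl)
  have hW0 : Tendsto W l (𝓝 0) := hWO.trans_tendsto hid
  have hd : (fun h => (u h, v h) - (z + W h)) =O[l] fun h => h ^ (n + 1) := by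
    refine (hu.prod_left hv).congr_left fun h => ?_
    ext <;> simp [hW, sub_sub]
  have hzW : Tendsto (fun h => z + W h) l (𝓝 z) := by
    simpa using hW0.const_add z
  have huv : Tendsto (fun h => (u h, v h)) l (𝓝 z) := by
    have h1 : Tendsto (fun h : ℝ => h ^ (n + 1)) l (𝓝 0) := by
      simpa using hid.pow (n + 1)
    simpa using (hd.trans_tendsto h1).add hzW
  have h1 : (fun h => F (u h, v h) - F (z + W h)) =O[l] fun h => h ^ (n + 1) :=
    ((hF.hasStrictFDerivAt one_ne_zero).isBigO_sub.comp_tendsto (huv.prodMk_nhds hzW)).trans hd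
  have h2 : (fun h => F (z + W h) - ∑ m ∈ Finset.range (p + 1), q m (fun _ => W h))
      =O[l] fun h => h ^ (n + 1) := by
    refine ((hq.comp_tendsto hW0).trans (hWO.norm_left.pow (p + 1))).trans ?_
    simpa using isBigO_pow_smul_const hl (Nat.succ_le_succ hn) (1 : ℝ)
  refine (h1.add h2).congr_left fun h => ?_
  rw [← taylorPolynomial_bSeries]
  simp [hW]

end EdgeColoredTree

/-! ### Expansion of the two solutions and sufficiency -/

namespace EdgeColoredTree

theorem childProd_stageWeight {s : ℕ} (M : NPRKMethod s) (i j : Fin s) :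
    childProd ![stageWeight M i, stageWeight M j] = fun τ => indexedWeight M τ i j := by
  funext ⟨m, col, child⟩
  rw [indexedWeight_node, childProd]

theorem childProd_density (τ : EdgeColoredTree) :
    childProd (fun _ σ => 1 / (σ.density : ℝ)) τ = τ.order * (1 / (τ.density : ℝ)) := by
  cases τ with
  | node m col child => rw [order_div_density, childProd]

section

universe u

variable {X : Type u} [NormedAddCommGroup X] [NormedSpace ℝ X] {F : X × X → X} {y₀ : X}
  {q : FormalMultilinearSeries ℝ (X × X) X} {p : ℕ}

theorem smul_sum_field_isBigO {s : ℕ} (M : NPRKMethod s) (hF : ContDiffAt ℝ 1 F (y₀, y₀))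
    (hq : (fun w => F ((y₀, y₀) + w) - ∑ m ∈ Finset.range (p + 1), q m (fun _ => w))
        =O[𝓝 0] fun w => ‖w‖ ^ (p + 1))
    {l : Filter ℝ} (hl : l ≤ 𝓝 0) {Y : ℝ → Fin s → X} {n : ℕ} (hn : n ≤ p)
    (hY : ∀ i, (fun h => Y h i - y₀ - bSeries q p n (stageWeight M i) h)
      =O[l] fun h => h ^ (n + 1)) (w : Fin s → Fin s → ℝ) :
    (fun h => h • ∑ i, ∑ j, w i j • F (Y h i, Y h j) -
        bSeries q p (n + 1) (fun τ => ∑ i, ∑ j, w i j * indexedWeight M τ i j) h)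
      =O[l] fun h => h ^ (n + 2) := by
  have h1 : ∀ i j, (fun h => w i j • (F (Y h i, Y h j) - ∑ τ ∈ boundedTrees p (n + 1),
      (h ^ (τ.order - 1) * childProd ![stageWeight M i, stageWeight M j] τ) • elemDiff q τ))
      =O[l] fun h => h ^ (n + 1) := fun i j =>
    (comp_bSeries_isBigO hn hF hq hl _ (hY i) (hY j)).const_smul_left (w i j)
  have h2 := (isBigO_refl (fun h : ℝ => h) l).smul
    (IsBigO.fun_sum fun i (_ : i ∈ Finset.univ) =>
      IsBigO.fun_sum fun j (_ : j ∈ Finset.univ) => h1 i j)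
  refine h2.congr (fun h => ?_) fun h => by simp [pow_succ']
  simp only [bSeries_sum, bSeries_const_mul, ← childProd_stageWeight, ← smul_sum_childProd,
    Finset.smul_sum, Finset.sum_sub_distrib, smul_sub, smul_comm h]

theorem isStages_isBigO {s : ℕ} (M : NPRKMethod s) (hF : ContDiffAt ℝ 1 F (y₀, y₀))
    (hq : (fun w => F ((y₀, y₀) + w) - ∑ m ∈ Finset.range (p + 1), q m (fun _ => w))
        =O[𝓝 0] fun w => ‖w‖ ^ (p + 1))
    {l : Filter ℝ} (hl : l ≤ 𝓝 0) {Y : ℝ → Fin s → X}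
    (hY : ∀ᶠ h in l, M.IsStages F y₀ h (Y h))
    (hlim : ∀ i, Tendsto (fun h => Y h i) l (𝓝 y₀)) {n : ℕ} (hn : n ≤ p) (i : Fin s) :
    (fun h => Y h i - y₀ - bSeries q p n (stageWeight M i) h) =O[l] fun h => h ^ (n + 1) := by
  induction n generalizing i with
  | zero =>
    -- There are no trees of zero levels, so the claim is `Y h i - y₀ = O(h)`: `F` stays bounded
    -- along stages tending to `y₀`.
    have h1 : ∀ j k, (fun h => M.a i j k • F (Y h j, Y h k)) =O[l] fun _ => (1 : ℝ) :=
      fun j k => ((hF.continuousAt.tendsto.comp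
        ((hlim j).prodMk_nhds (hlim k))).isBigO_one ℝ).const_smul_left _
    have h2 := (isBigO_refl (fun h : ℝ => h) l).smul
      (IsBigO.fun_sum fun j (_ : j ∈ Finset.univ) =>
        IsBigO.fun_sum fun k (_ : k ∈ Finset.univ) => h1 j k)
    refine h2.congr' ?_ (by simp)
    filter_upwards [hY] with h hh
    simpa [bSeries, boundedTrees] using (sub_eq_of_eq_add' (hh i)).symm
  | succ n ih =>
    refine (smul_sum_field_isBigO M hF hq hl (Nat.le_of_succ_le hn)
      (fun j => ih (Nat.le_of_succ_le hn) j) (M.a i)).congr' ?_ EventuallyEq.rfl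
    filter_upwards [hY] with h hh
    rw [hh i, add_sub_cancel_left]
    rfl

theorem hasDerivAt_bSeries_density (n : ℕ) (t : ℝ) :
    HasDerivAt (bSeries q p n fun τ => 1 / (τ.density : ℝ))
      (∑ τ ∈ boundedTrees p n,
        (t ^ (τ.order - 1) * childProd (fun _ σ => 1 / (σ.density : ℝ)) τ) • elemDiff q τ) t := by
  refine HasDerivAt.fun_sum fun τ _ => ?_
  refine (((hasDerivAt_pow τ.order t).mul_const _).smul_const _).congr_deriv ?_
  rw [childProd_density]
  congr 1
  ring

theorem isPartitionedSolution_isBigO (hF : ContDiffAt ℝ 1 F (y₀, y₀))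
    (hq : (fun w => F ((y₀, y₀) + w) - ∑ m ∈ Finset.range (p + 1), q m (fun _ => w))
        =O[𝓝 0] fun w => ‖w‖ ^ (p + 1))
    {t₀ : ℝ} {y : ℝ → X} (hy : IsPartitionedSolution F t₀ y₀ y) {n : ℕ} (hn : n ≤ p + 1) :
    (fun t => y (t₀ + t) - y₀ - bSeries q p n (fun τ => 1 / (τ.density : ℝ)) t)
      =O[𝓝 0] fun t => t ^ (n + 1) := by
  obtain ⟨hy0, hy⟩ := hy
  have ht : Tendsto (fun t : ℝ => t₀ + t) (𝓝 0) (𝓝 t₀) := by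
    simpa using (continuous_const_add t₀).tendsto (0 : ℝ)
  induction n with
  | zero =>
    have h1 := hy.self_of_nhds.differentiableAt.isBigO_sub.comp_tendsto ht
    simpa [Function.comp_def, hy0, bSeries, boundedTrees] using h1
  | succ n ih =>
    have hn' : n ≤ p := Nat.le_of_succ_le_succ hn
    have ih := ih (hn'.trans p.le_succ)
    refine isBigO_of_hasDerivAt_isBigO ?_ ?_ (comp_bSeries_isBigO hn' hF hq le_rfl
      (fun _ σ => 1 / (σ.density : ℝ)) ih ih)
    · simp [hy0, bSeries, (order_pos _).ne']
    · filter_upwards [ht.eventually hy] with t hyt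
      exact ((hyt.comp_const_add t₀ t).sub_const y₀).sub (hasDerivAt_bSeries_density (n + 1) t)

end

end EdgeColoredTree

open EdgeColoredTree in
theorem NPRKMethod.hasOrder_of_weight_eq {s : ℕ} (M : NPRKMethod s) {p : ℕ} {r : WithTop ℕ∞}
    (hr : (p : WithTop ℕ∞) + 1 ≤ r)
    (hM : ∀ τ : EdgeColoredTree, τ.order ≤ p → τ.weight M = 1 / (τ.density : ℝ)) :
    M.HasOrder r p := by
  intro X _ _ _ F t₀ y₀ y Y hF hy hY hlim
  have hFp := hF.of_le hr
  have hF1 : ContDiffAt ℝ 1 F (y₀, y₀) := hFp.of_le le_add_self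
  obtain ⟨q, hq⟩ := hFp.exists_taylor_isBigO p
  have hl : 𝓝[>] (0 : ℝ) ≤ 𝓝 0 := nhdsWithin_le_nhds
  have hpow : (fun h : ℝ => h ^ (p + 2)) =O[𝓝[>] 0] fun h => h ^ (p + 1) := by
    simpa using isBigO_pow_smul_const hl (p + 1).le_succ (1 : ℝ)
  have h1 := ((isPartitionedSolution_isBigO hF1 hq hy le_rfl).mono hl).trans hpow
  have h2 := (smul_sum_field_isBigO M hF1 hq hl le_rfl
    (fun i => isStages_isBigO M hF1 hq hl hY hlim le_rfl i) M.b).trans hpow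
  -- `boundedTrees` also contains trees of order above `p`; their terms are already `O(h^(p+1))`.
  have h3 : (fun h : ℝ => ∑ τ ∈ boundedTrees p (p + 1),
      h ^ τ.order • (1 / (τ.density : ℝ) - τ.weight M) • elemDiff q τ)
      =O[𝓝[>] 0] fun h => h ^ (p + 1) := by
    refine IsBigO.fun_sum fun τ _ => ?_
    rcases le_or_gt τ.order p with h | h
    · simpa [hM τ h] using isBigO_zero _ _
    · exact isBigO_pow_smul_const hl h _
  refine ((h1.sub h2).add h3).congr_left fun h => ?_
  have h4 : (∑ τ ∈ boundedTrees p (p + 1),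
      h ^ τ.order • (1 / (τ.density : ℝ) - τ.weight M) • elemDiff q τ) =
      bSeries q p (p + 1) (fun τ => 1 / (τ.density : ℝ)) h -
        bSeries q p (p + 1) (fun τ => ∑ i, ∑ j, M.b i j * indexedWeight M τ i j) h := by
    rw [bSeries, bSeries, ← Finset.sum_sub_distrib]
    refine Finset.sum_congr rfl fun τ _ => ?_
    rw [← sub_smul, ← mul_sub, mul_smul]
    rfl
  rw [h4, NPRKMethod.update]
  abel

theorem theorem3p1 (s : ℕ) (M : NPRKMethod s) (p : ℕ) (r : WithTop ℕ∞)
    (hr : (p : WithTop ℕ∞) + 1 ≤ r) :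
    M.HasOrder r p ↔
      ∀ τ : EdgeColoredTree, τ.order ≤ p → τ.weight M = 1 / (τ.density : ℝ) :=
  ⟨fun h => h.weight_eq, M.hasOrder_of_weight_eq hr⟩
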